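/- For $x\in\mathbb R$ let $\langle x\rangle$ denote the distance from $x$ to the nearest integer, and let $\mathbb N=\{1,2,3,\dots\}$. The multiplicative exponent $\omega^\times(a,b)\in[-\infty,\infty]$ of $(a,b)\in\mathbb R^2$ is the supremum of the set of real numbers $w$ such that $\langle na\rangle\langle nb\rangle\le n^{-w}$ for infinitely many $n\in\mathbb N$. Let \[ L_{a,b}:=\{(\alpha,\beta)\in\mathbb R^2:\ \alpha=a\beta+b\}. \] Theorem 1.7. Let $(a,b)\in\mathbb R^2$ with $\omega^\times(a,b)<4$, and let $\psi:\mathbb N\to\mathbb R_{\ge 0}$ be a decreasing (that is, non-increasing) function such that \[ \sum_{n=1}^\infty \psi(n)\log n<\infty . \] Then for almost all $(\alpha,\beta)\in L_{a,b}$, with respect to the induced Lebesgue measure on the line $L_{a,b}$, there exist at most finitely many $n\in\mathbb N$ for which \[ \langle n\alpha\rangle\,\langle n\beta\rangle<\psi(n). \] -/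

import Mathlib

open MeasureTheory
open scoped NNReal

/-- The distance `⟨x⟩` from a real number `x` to the nearest integer. -/
noncomputable def distNearestInt (x : ℝ) : ℝ := |x - round x|

/-- The multiplicative exponent `ω^×(a,b)`: the supremum, in the extended reals, of the real
numbers `w` such that `⟨na⟩ ⟨nb⟩ ≤ n ^ (-w)` for infinitely many positive integers `n`. -/
noncomputable def multiplicativeExponent (a b : ℝ) : EReal :=
  sSup ((fun w : ℝ => (w : EReal)) ''
    {w : ℝ | {n : ℕ | 1 ≤ n ∧
      distNearestInt (n * a) * distNearestInt (n * b) ≤ (n : ℝ) ^ (-w)}.Infinite})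

/-- The planar line `L_{a,b} = {(α, β) : α = a β + b}`. -/
def planarLine (a b : ℝ) : Set (EuclideanSpace ℝ (Fin 2)) :=
  {p | p 0 = a * p 1 + b}

/-- The induced Lebesgue measure (arc length) on `L_{a,b}`, regarded as a measure on the Euclidean
plane: one-dimensional Hausdorff measure restricted to the line. -/
noncomputable def planarLineMeasure (a b : ℝ) : Measure (EuclideanSpace ℝ (Fin 2)) :=
  (Measure.hausdorffMeasure 1).restrict (planarLine a b)

/-! ### Exponential sums -/

/-! Parametrise the line by `β` and apply Borel–Cantelli over dyadic blocks `N = 2^k ≤ n < 2N`.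
Replace `ψ` on a block by `φ = ψ(N) + N^(-s)` with some `s > 1`; the series `∑ N k φ` still
converges. Split further by the size `ρ = 2^(-j)` of the larger of the two distances; the smaller is
then at most `η = 2φ/ρ`, and only `O(k)` values of `j` matter because `φ ≥ N^(-s)`.

If `m`, `l` are the integers nearest to `nβ`, `n(aβ + b)` and both distances are at most `ρ`, then
`am + bn - l = O(ρ)`, so `(m, n)` lies in a dual Bohr set. Given `(m, n)`, `β` is confined to `O(1)`
intervals of length `O(η/N)` (`volume_blockSet_le`). The crux is the expected count `O(ρN²)` of such
pairs (`card_dualBohrSet_le`). It makes each piece of measure `O(ρN² · η/N) = O(Nφ)`, hence each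
block `O(Nkφ)`.

The count comes from a duality of large sieve type (`card_dualBohr_mul_le`): it holds as soon as the
points `q(a, b)` modulo one, for `q` up to about `1/ρ ≤ 2N^(s/2)`, stay at distance at least `1/M`
from the origin, `M ≍ N`. The condition `ω^×(a,b) < 4` provides this for some `s > 1`
(`exists_scale`). -/

theorem distNearestInt_le (x : ℝ) (z : ℤ) : distNearestInt x ≤ |x - z| := round_le x z

theorem distNearestInt_nonneg (x : ℝ) : 0 ≤ distNearestInt x := abs_nonneg _

theorem distNearestInt_le_half (x : ℝ) : distNearestInt x ≤ 1 / 2 := abs_sub_round x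

theorem distNearestInt_neg (x : ℝ) : distNearestInt (-x) = distNearestInt x := by
  refine le_antisymm ?_ ?_
  · refine (distNearestInt_le (-x) (-round x)).trans (le_of_eq ?_)
    rw [distNearestInt, ← abs_neg]; congr 1; push_cast; ring
  · refine (distNearestInt_le x (-round (-x))).trans (le_of_eq ?_)
    rw [distNearestInt, ← abs_neg]; congr 1; push_cast; ring

/-- The additive character `x ↦ exp (2πix)`. -/
noncomputable def unitExp (x : ℝ) : ℂ := Complex.exp (((2 * Real.pi * x : ℝ) : ℂ) * Complex.I)

theorem unitExp_add (x y : ℝ) : unitExp (x + y) = unitExp x * unitExp y := by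
  rw [unitExp, unitExp, unitExp, ← Complex.exp_add]; congr 1; push_cast; ring

theorem norm_unitExp (x : ℝ) : ‖unitExp x‖ = 1 := Complex.norm_exp_ofReal_mul_I _

theorem conj_unitExp (x : ℝ) : (starRingEnd ℂ) (unitExp x) = unitExp (-x) := by
  rw [unitExp, unitExp, ← Complex.exp_conj, map_mul, Complex.conj_ofReal, Complex.conj_I]
  congr 1; push_cast; ring

theorem unitExp_nat_mul (n : ℕ) (x : ℝ) : unitExp (n * x) = unitExp x ^ n := by
  rw [unitExp, unitExp, ← Complex.exp_nat_mul]; congr 1; push_cast; ring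

theorem unitExp_re (x : ℝ) : (unitExp x).re = Real.cos (2 * Real.pi * x) :=
  Complex.exp_ofReal_mul_I_re _

theorem norm_unitExp_sub_one (x : ℝ) : 4 * distNearestInt x ≤ ‖unitExp x - 1‖ := by
  have h : unitExp x = unitExp (x - round x) := by
    rw [unitExp, unitExp, Complex.exp_eq_exp_iff_exists_int]
    exact ⟨round x, by push_cast; ring⟩
  have ht : |x - round x| ≤ 1 / 2 := abs_sub_round x
  rw [h, distNearestInt]
  generalize x - round x = t at ht
  rw [unitExp, mul_comm _ Complex.I, Complex.norm_exp_I_mul_ofReal_sub_one, Real.norm_eq_abs, abs_mul]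
  have h1 : |2 * Real.pi * t / 2| = Real.pi * |t| := by
    rw [show 2 * Real.pi * t / 2 = Real.pi * t by ring, abs_mul, abs_of_pos Real.pi_pos]
  have h2 := Real.mul_abs_le_abs_sin (x := 2 * Real.pi * t / 2)
    (by rw [h1]; nlinarith [Real.pi_pos])
  rw [h1] at h2
  have h3 : 2 / Real.pi * (Real.pi * |t|) = 2 * |t| := by field_simp
  rw [h3] at h2
  rw [abs_of_pos (by norm_num : (0 : ℝ) < 2)]
  linarith

/-- The Dirichlet-type sum `∑_{j < L} exp (2πi·jx)`. -/
noncomputable def expSum (L : ℕ) (x : ℝ) : ℂ := ∑ i ∈ Finset.range L, unitExp (i * x)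

theorem norm_expSum_le (L : ℕ) (x : ℝ) : ‖expSum L x‖ ≤ L := by
  refine (norm_sum_le _ _).trans ?_
  simp [norm_unitExp]

theorem norm_expSum_mul_le (L : ℕ) (x : ℝ) : ‖expSum L x‖ * (2 * distNearestInt x) ≤ 1 := by
  have h : expSum L x * (unitExp x - 1) = unitExp x ^ L - 1 := by
    rw [expSum, ← geom_sum_mul]; simp only [unitExp_nat_mul]
  have h1 : ‖expSum L x‖ * ‖unitExp x - 1‖ ≤ 2 := by
    rw [← norm_mul, h]
    refine (norm_sub_le _ _).trans ?_
    rw [norm_pow, norm_unitExp]; norm_num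
  nlinarith [norm_unitExp_sub_one x, norm_nonneg (expSum L x),
    mul_le_mul_of_nonneg_left (norm_unitExp_sub_one x) (norm_nonneg (expSum L x))]

/-- All phases stay within `2π/8 < 1` radian of zero, so no term cancels: each has real part at
least `1 - 1/2`. -/
theorem half_le_norm_expSum {H : ℕ} {x : ℝ} (hx : ∀ h < H, h * distNearestInt x ≤ 1 / 8) :
    (H : ℝ) / 2 ≤ ‖expSum H x‖ := by
  refine le_trans ?_ (Complex.re_le_norm _)
  rw [expSum, Complex.re_sum]
  have : ∀ h ∈ Finset.range H, (1 / 2 : ℝ) ≤ (unitExp (h * x)).re := by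
    intro h hh
    have h0 := hx h (Finset.mem_range.1 hh)
    rw [unitExp_re]
    have h1 : Real.cos (2 * Real.pi * (h * x)) = Real.cos (2 * Real.pi * (h * (x - round x))) := by
      rw [← Real.cos_sub_int_mul_two_pi _ (h * round x)]
      congr 1; push_cast; ring
    rw [h1]
    refine le_trans ?_ (Real.one_sub_sq_div_two_le_cos)
    have h2 : |2 * Real.pi * (h * (x - round x))| ≤ 1 := by
      rw [abs_mul (2 * Real.pi), abs_mul (h : ℝ), abs_of_pos (by positivity : 0 < 2 * Real.pi),
        Nat.abs_cast]
      rw [distNearestInt] at h0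
      nlinarith [Real.pi_lt_four, Real.pi_pos]
    have := (sq_le_one_iff_abs_le_one _).2 h2
    linarith
  have := Finset.card_nsmul_le_sum _ _ _ this
  simp only [Finset.card_range, nsmul_eq_mul] at this
  linarith

theorem norm_expSum_sq (L : ℕ) (x : ℝ) : ((‖expSum L x‖ ^ 2 : ℝ) : ℂ) =
    ∑ p ∈ Finset.range L ×ˢ Finset.range L, unitExp (((p.1 : ℝ) - p.2) * x) := by
  rw [Complex.ofReal_pow, ← Complex.mul_conj', expSum, map_sum, Finset.sum_mul_sum,
    Finset.sum_product]
  refine Finset.sum_congr rfl fun i _ => Finset.sum_congr rfl fun j _ => ?_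
  rw [conj_unitExp, ← unitExp_add]; congr 1; ring

/-- Duality: expand every square into characters and exchange the order of summation. -/
theorem sum_norm_expSum_sq (L H : ℕ) (a b : ℝ) :
    ∑ p ∈ Finset.range L ×ˢ Finset.range L, ∑ q ∈ Finset.range L ×ˢ Finset.range L,
      ‖expSum H (a * ((p.1 : ℝ) - p.2) + b * ((q.1 : ℝ) - q.2))‖ ^ 2 =
    ∑ r ∈ Finset.range H ×ˢ Finset.range H,
      ‖expSum L (((r.1 : ℝ) - r.2) * a)‖ ^ 2 * ‖expSum L (((r.1 : ℝ) - r.2) * b)‖ ^ 2 := by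
  apply Complex.ofReal_injective
  simp only [Complex.ofReal_sum, Complex.ofReal_mul, norm_expSum_sq, Finset.sum_mul_sum]
  rw [Finset.sum_congr rfl fun p _ => Finset.sum_comm, Finset.sum_comm]
  refine Finset.sum_congr rfl fun r _ => Finset.sum_congr rfl fun p _ =>
    Finset.sum_congr rfl fun q _ => ?_
  rw [← unitExp_add]; congr 1; ring

theorem sum_one_div_sq_le (T : ℕ) : ∑ u ∈ Finset.range T, 1 / ((u : ℝ) + 1) ^ 2 ≤ 2 := by
  have key : ∀ T : ℕ, ∑ u ∈ Finset.range (T + 1), 1 / ((u : ℝ) + 1) ^ 2 ≤ 2 - 1 / ((T : ℝ) + 1) := by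
    intro T
    induction T with
    | zero => norm_num
    | succ T ih =>
      rw [Finset.sum_range_succ]
      have : 1 / (((T + 1 : ℕ) : ℝ) + 1) ^ 2 ≤
          1 / ((T : ℝ) + 1) - 1 / (((T + 1 : ℕ) : ℝ) + 1) := by
        push_cast
        rw [div_sub_div _ _ (by positivity) (by positivity), div_le_div_iff₀ (by positivity)
          (by positivity)]
        nlinarith [(Nat.cast_nonneg T : (0 : ℝ) ≤ T)]
      linarith
  cases T with
  | zero => norm_num
  | succ T =>
    have := key T
    have : 0 ≤ 1 / ((T : ℝ) + 1) := by positivity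
    linarith

/-! ### Points that are separated modulo one -/

/-- The index of the interval `[u / T, (u + 1) / T)` containing `x` modulo one. -/
noncomputable def cellIndex (T : ℕ) (x : ℝ) : ℕ := ⌊T * Int.fract x⌋₊

theorem cellIndex_lt {T : ℕ} (hT : 0 < T) (x : ℝ) : cellIndex T x < T := by
  have hT' : (0 : ℝ) < T := by exact_mod_cast hT
  rw [cellIndex, Nat.floor_lt (mul_nonneg hT'.le (Int.fract_nonneg x))]
  nlinarith [Int.fract_lt_one x]

theorem distNearestInt_sub_lt_of_cellIndex_eq {T : ℕ} (hT : 0 < T) {x y : ℝ}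
    (h : cellIndex T x = cellIndex T y) : distNearestInt (x - y) < 1 / T := by
  have hT' : (0 : ℝ) < T := by exact_mod_cast hT
  have hx := mul_nonneg hT'.le (Int.fract_nonneg x)
  have hy := mul_nonneg hT'.le (Int.fract_nonneg y)
  have h1 := Nat.floor_le hx
  have h2 := Nat.lt_floor_add_one (T * Int.fract x)
  have h3 := Nat.floor_le hy
  have h4 := Nat.lt_floor_add_one (T * Int.fract y)
  rw [cellIndex, cellIndex] at h
  rw [h] at h1 h2
  refine (distNearestInt_le _ (⌊x⌋ - ⌊y⌋)).trans_lt ?_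
  have e : x - y - ((⌊x⌋ - ⌊y⌋ : ℤ) : ℝ) = Int.fract x - Int.fract y := by
    rw [Int.fract, Int.fract]; push_cast; ring
  rw [e, abs_lt, lt_div_iff₀ hT', neg_lt, lt_div_iff₀ hT']
  constructor <;> nlinarith

theorem cellIndex_div_le {T : ℕ} (hT : 0 < T) (x : ℝ) :
    min (cellIndex T x : ℝ) (T - 1 - cellIndex T x) ≤ T * distNearestInt x := by
  have hT' : (0 : ℝ) < T := by exact_mod_cast hT
  have hx := mul_nonneg hT'.le (Int.fract_nonneg x)
  have h1 := Nat.floor_le hx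
  have h2 := Nat.lt_floor_add_one (T * Int.fract x)
  rw [distNearestInt, abs_sub_round_eq_min, cellIndex, mul_min_of_nonneg _ _ hT'.le]
  exact min_le_min h1 (by linarith)

/-- Combines the trivial bound with the decay `1 / (2⟨x⟩)`. The two terms count cells from either
end of `[0, 1)`, since `x` may be near an integer from above or below. -/
theorem sq_norm_expSum_le {T : ℕ} (hT : 0 < T) (x : ℝ) :
    ‖expSum (3 * T) x‖ ^ 2 ≤ 9 * T ^ 2 * (1 / ((cellIndex T x : ℝ) + 1) ^ 2 +
      1 / (((T - 1 - cellIndex T x : ℕ) : ℝ) + 1) ^ 2) := by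
  have hT' : (0 : ℝ) < T := by exact_mod_cast hT
  have hlt := cellIndex_lt hT x
  have hmin := cellIndex_div_le hT x
  have hc : ((T - 1 - cellIndex T x : ℕ) : ℝ) = T - 1 - cellIndex T x := by
    rw [Nat.cast_sub (by omega), Nat.cast_sub (by omega), Nat.cast_one]
  rw [← hc] at hmin
  have h1 := norm_expSum_le (3 * T) x
  have h2 := norm_expSum_mul_le (3 * T) x
  have key : ∀ u : ℕ, (u : ℝ) ≤ T * distNearestInt x →
      ‖expSum (3 * T) x‖ ^ 2 ≤ 9 * T ^ 2 * (1 / ((u : ℝ) + 1) ^ 2) := by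
    intro u hu
    have h3 : ‖expSum (3 * T) x‖ * (u + 1) ≤ 3 * T := by
      push_cast at h1
      rcases Nat.eq_zero_or_pos u with rfl | hu0
      · simpa using h1
      · have hu1 : (1 : ℝ) ≤ u := by exact_mod_cast hu0
        have h0 := norm_nonneg (expSum (3 * T) x)
        have : ‖expSum (3 * T) x‖ * u ≤ ‖expSum (3 * T) x‖ * (T * distNearestInt x) :=
          mul_le_mul_of_nonneg_left hu h0
        have : ‖expSum (3 * T) x‖ * 1 ≤ ‖expSum (3 * T) x‖ * u :=
          mul_le_mul_of_nonneg_left hu1 h0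
        have : T * (‖expSum (3 * T) x‖ * (2 * distNearestInt x)) ≤ T * 1 :=
          mul_le_mul_of_nonneg_left h2 hT'.le
        nlinarith
    rw [mul_one_div, le_div_iff₀ (by positivity), ← mul_pow]
    calc _ ≤ (3 * (T : ℝ)) ^ 2 := pow_le_pow_left₀ (by positivity) h3 2
      _ = _ := by ring
  rw [mul_add]
  rcases min_le_iff.1 hmin with h | h
  · exact (key _ h).trans (le_add_of_nonneg_right (by positivity))
  · exact (key _ h).trans (le_add_of_nonneg_left (by positivity))

/-- Separated points occupy distinct cells of a `T × T` grid, so the sum is dominated by a full grid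
sum, which factors into two convergent inverse-square sums. The bound does not depend on the number
of points. -/
theorem sum_sq_norm_expSum_mul_le {ι : Type*} {T : ℕ} (hT : 0 < T) (s : Finset ι) (x y : ι → ℝ)
    (hsep : ∀ i ∈ s, ∀ j ∈ s, i ≠ j →
      1 / (T : ℝ) ≤ max (distNearestInt (x i - x j)) (distNearestInt (y i - y j))) :
    ∑ i ∈ s, ‖expSum (3 * T) (x i)‖ ^ 2 * ‖expSum (3 * T) (y i)‖ ^ 2 ≤ 1296 * (T : ℝ) ^ 4 := by
  set f : ℕ → ℝ := fun u => 9 * T ^ 2 * (1 / ((u : ℝ) + 1) ^ 2 +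
    1 / (((T - 1 - u : ℕ) : ℝ) + 1) ^ 2) with hf
  have hf0 : ∀ u, 0 ≤ f u := fun u => by positivity
  have hsum : ∑ u ∈ Finset.range T, f u ≤ 36 * T ^ 2 := by
    rw [hf, ← Finset.mul_sum, Finset.sum_add_distrib,
      Finset.sum_range_reflect (fun u : ℕ => 1 / ((u : ℝ) + 1) ^ 2) T]
    nlinarith [sum_one_div_sq_le T, sq_nonneg (T : ℝ)]
  set g : ι → ℕ × ℕ := fun i => (cellIndex T (x i), cellIndex T (y i)) with hg
  have hinj : Set.InjOn g s := by
    intro i hi j hj hij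
    by_contra hne
    rw [hg, Prod.mk.injEq] at hij
    exact absurd (hsep i hi j hj hne) (not_le.2 (max_lt
      (distNearestInt_sub_lt_of_cellIndex_eq hT hij.1)
      (distNearestInt_sub_lt_of_cellIndex_eq hT hij.2)))
  calc _ ≤ ∑ i ∈ s, f (g i).1 * f (g i).2 := Finset.sum_le_sum fun i _ =>
        mul_le_mul (sq_norm_expSum_le hT _) (sq_norm_expSum_le hT _) (by positivity) (hf0 _)
    _ = ∑ p ∈ s.image g, f p.1 * f p.2 := 
        (Finset.sum_image (f := fun p : ℕ × ℕ => f p.1 * f p.2) hinj).symm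
    _ ≤ ∑ p ∈ Finset.range T ×ˢ Finset.range T, f p.1 * f p.2 := by
        refine Finset.sum_le_sum_of_subset_of_nonneg ?_ fun p _ _ => mul_nonneg (hf0 _) (hf0 _)
        intro p hp
        obtain ⟨i, -, rfl⟩ := Finset.mem_image.1 hp
        simp [hg, cellIndex_lt hT]
    _ = (∑ u ∈ Finset.range T, f u) * ∑ u ∈ Finset.range T, f u := by
        rw [Finset.sum_mul_sum, Finset.sum_product]
    _ ≤ (36 * T ^ 2) * (36 * T ^ 2) :=
        mul_le_mul hsum hsum (Finset.sum_nonneg fun u _ => hf0 u) (by positivity)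
    _ = _ := by ring

/-! ### Counting points of dual Bohr sets -/

/-- Compare two evaluations of one moment. Each element of `B` contributes at least `M²` terms of
size `(H/2)²`; on the dual side, separation bounds the sum by `1296 M⁴` for each of the `H` values
of one index. -/
theorem card_dualBohr_mul_le {M H : ℕ} (hM : 0 < M) (hH : 0 < H) (a b : ℝ) (B : Finset (ℤ × ℤ))
    (hB : B ⊆ Finset.Ico (-(M : ℤ)) M ×ˢ Finset.Ico (-(M : ℤ)) M)
    (hB' : ∀ p ∈ B, ∀ h < H, h * distNearestInt (a * p.1 + b * p.2) ≤ 1 / 8)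
    (hsep : ∀ q : ℕ, 1 ≤ q → q < H →
      1 / (M : ℝ) ≤ max (distNearestInt (q * a)) (distNearestInt (q * b))) :
    (B.card : ℝ) * H ≤ 5184 * M ^ 2 := by
  have hM' : (0 : ℝ) < M := by exact_mod_cast hM
  have hH' : (0 : ℝ) < H := by exact_mod_cast hH
  have hsepZ : ∀ i ∈ Finset.range H, ∀ j ∈ Finset.range H, i ≠ j → 1 / (M : ℝ) ≤
      max (distNearestInt (((i : ℝ) - j) * a)) (distNearestInt (((i : ℝ) - j) * b)) := by
    intro i hi j hj hij
    rw [Finset.mem_range] at hi hj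
    rcases lt_or_gt_of_ne hij with h | h
    · have := hsep (j - i) (by omega) (by omega)
      rw [Nat.cast_sub h.le] at this
      rw [← distNearestInt_neg (((i : ℝ) - j) * a), ← distNearestInt_neg (((i : ℝ) - j) * b),
        ← neg_mul, ← neg_mul, neg_sub]
      exact this
    · have := hsep (i - j) (by omega) (by omega)
      rwa [Nat.cast_sub h.le] at this
  have hupper : ∑ r ∈ Finset.range H ×ˢ Finset.range H,
      ‖expSum (3 * M) (((r.1 : ℝ) - r.2) * a)‖ ^ 2 *
        ‖expSum (3 * M) (((r.1 : ℝ) - r.2) * b)‖ ^ 2 ≤ H * (1296 * (M : ℝ) ^ 4) := by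
    rw [Finset.sum_product]
    refine (Finset.sum_le_card_nsmul _ _ (1296 * (M : ℝ) ^ 4) fun i _ => ?_).trans
      (by rw [Finset.card_range, nsmul_eq_mul])
    refine sum_sq_norm_expSum_mul_le hM (Finset.range H) (fun j => ((i : ℝ) - j) * a)
      (fun j => ((i : ℝ) - j) * b) fun j hj k hk hjk => ?_
    have := hsepZ k hk j hj hjk.symm
    simp only [← sub_mul]
    rwa [show (i : ℝ) - j - (i - k) = k - j by ring]
  set P := Finset.range (3 * M) ×ˢ Finset.range (3 * M) with hP
  set G : (ℕ × ℕ) × (ℕ × ℕ) → ℝ := fun w =>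
    ‖expSum H (a * ((w.1.1 : ℝ) - w.1.2) + b * ((w.2.1 : ℝ) - w.2.2))‖ ^ 2 with hG
  set S := (P ×ˢ P).filter fun w =>
    (((w.1.1 : ℤ) - w.1.2, (w.2.1 : ℤ) - w.2.2) : ℤ × ℤ) ∈ B with hS
  -- Each `m ∈ [-M, M)` is `(M + u + m) - (M + u)` for every `u < M`, with both entries in `[0,
  -- 3M)`; this explains the length `3 * M`.
  have hcard : (M * M) * B.card ≤ S.card := by
    have : ((Finset.range M ×ˢ Finset.range M) ×ˢ B).card = (M * M) * B.card := by
      simp [Finset.card_product]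
    rw [← this]
    refine Finset.card_le_card_of_injOn (fun v =>
      (((M + v.1.1 + v.2.1).toNat, M + v.1.1), ((M + v.1.2 + v.2.2).toNat, M + v.1.2))) ?_ ?_
    · rintro ⟨⟨u, v⟩, ⟨m, n⟩⟩ hv
      simp only [Finset.coe_product, Set.mem_prod, Finset.mem_coe, Finset.mem_range] at hv
      have hmn := hB hv.2
      simp only [Finset.mem_product, Finset.mem_Ico] at hmn
      have e1 : (((M + u + m : ℤ).toNat : ℕ) : ℤ) = M + u + m := Int.toNat_of_nonneg (by omega)
      have e2 : (((M + v + n : ℤ).toNat : ℕ) : ℤ) = M + v + n := Int.toNat_of_nonneg (by omega)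
      simp only [hS, hP, Finset.coe_filter, Finset.mem_product, Finset.mem_range, Set.mem_ofPred_eq]
      refine ⟨⟨⟨by omega, by omega⟩, by omega, by omega⟩, ?_⟩
      rw [e1, e2]
      push_cast
      simpa using hv.2
    · rintro ⟨⟨u, v⟩, ⟨m, n⟩⟩ hv ⟨⟨u', v'⟩, ⟨m', n'⟩⟩ hv' h
      simp only [Finset.coe_product, Set.mem_prod, Finset.mem_coe, Finset.mem_range] at hv hv'
      have hmn := hB hv.2
      have hmn' := hB hv'.2
      simp only [Finset.mem_product, Finset.mem_Ico] at hmn hmn'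
      simp only [Prod.mk.injEq] at h ⊢
      omega
  have hlower : S.card * ((H : ℝ) / 2) ^ 2 ≤ ∑ w ∈ P ×ˢ P, G w := by
    refine le_trans ?_ (Finset.sum_le_sum_of_subset_of_nonneg (s := S) (f := G)
      (Finset.filter_subset _ _) fun w _ _ => by positivity)
    rw [← nsmul_eq_mul]
    refine Finset.card_nsmul_le_sum _ _ _ fun w hw => ?_
    refine pow_le_pow_left₀ (by positivity) (half_le_norm_expSum fun h hh => ?_) 2
    have := hB' _ (Finset.mem_filter.1 hw).2 h hh
    push_cast at this
    exact this
  have heq : ∑ w ∈ P ×ˢ P, G w ≤ H * (1296 * (M : ℝ) ^ 4) := by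
    rw [Finset.sum_product]
    exact (sum_norm_expSum_sq (3 * M) H a b).trans_le hupper
  have h1 : ((M * M) * B.card : ℝ) * ((H : ℝ) / 2) ^ 2 ≤ H * (1296 * (M : ℝ) ^ 4) :=
    le_trans (mul_le_mul_of_nonneg_right (by exact_mod_cast hcard) (by positivity))
      (hlower.trans heq)
  have h2 : ((M : ℝ) ^ 2 * H) * (B.card * H) ≤ ((M : ℝ) ^ 2 * H) * (5184 * M ^ 2) := by
    nlinarith
  exact le_of_mul_le_mul_left h2 (by positivity)

/-! ### The Diophantine condition -/

theorem distNearestInt_mul_le (m : ℕ) (x : ℝ) :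
    distNearestInt (m * x) ≤ m * distNearestInt x := by
  refine (distNearestInt_le _ (m * round x)).trans (le_of_eq ?_)
  push_cast
  rw [← mul_sub, abs_mul, Nat.abs_cast, distNearestInt]

theorem exists_real_exponent {a b : ℝ} (hab : multiplicativeExponent a b < 4) :
    ∃ w : ℝ, 1 < w ∧ w < 4 ∧ {n : ℕ | 1 ≤ n ∧
      distNearestInt (n * a) * distNearestInt (n * b) ≤ (n : ℝ) ^ (-w)}.Finite := by
  have h4 : max (multiplicativeExponent a b) ((1 : ℝ) : EReal) < ((4 : ℝ) : EReal) :=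
    max_lt (by exact_mod_cast hab) (by exact_mod_cast (by norm_num : (1 : ℝ) < 4))
  obtain ⟨w, hw1, hw2⟩ := EReal.lt_iff_exists_real_btwn.1 h4
  rw [max_lt_iff] at hw1
  refine ⟨w, by exact_mod_cast hw1.2, by exact_mod_cast hw2, ?_⟩
  by_contra hinf
  exact absurd (le_sSup (Set.mem_image_of_mem _ hinf)) (not_le.2 hw1.1)

theorem exists_lower_bound {a b w : ℝ} (hfin : {n : ℕ | 1 ≤ n ∧
      distNearestInt (n * a) * distNearestInt (n * b) ≤ (n : ℝ) ^ (-w)}.Finite) :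
    ∃ c : ℝ, 0 < c ∧ ∀ q : ℕ, 1 ≤ q →
      c * (q : ℝ) ^ (-w) ≤ distNearestInt (q * a) * distNearestInt (q * b) := by
  have hpos : ∀ q : ℕ, 1 ≤ q → 0 < distNearestInt (q * a) * distNearestInt (q * b) := by
    intro q hq
    refine lt_of_le_of_ne (mul_nonneg (distNearestInt_nonneg _) (distNearestInt_nonneg _)) ?_
    intro h0
    -- A zero product at `q` persists at all multiples of `q`, giving infinitely many solutions.
    refine Set.infinite_of_injective_forall_mem (f := fun m : ℕ => (m + 1) * q) ?_ ?_ hfin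
    · intro m m' h
      have := Nat.eq_of_mul_eq_mul_right hq h
      omega
    · intro m
      refine ⟨Nat.mul_pos m.succ_pos hq, ?_⟩
      have hz : ∀ x : ℝ, distNearestInt (q * x) = 0 →
          distNearestInt (((m + 1) * q : ℕ) * x) = 0 := by
        intro x hx
        refine le_antisymm ?_ (distNearestInt_nonneg _)
        rw [Nat.cast_mul, mul_assoc]
        refine (distNearestInt_mul_le _ _).trans ?_
        rw [hx, mul_zero]
      have hprod : distNearestInt (((m + 1) * q : ℕ) * a) *
          distNearestInt (((m + 1) * q : ℕ) * b) = 0 := by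
        rcases mul_eq_zero.1 h0.symm with h | h
        · rw [hz a h, zero_mul]
        · rw [hz b h, mul_zero]
      rw [hprod]
      positivity
  obtain ⟨Q, hQ⟩ := hfin.bddAbove
  have hne : (Finset.Icc 0 Q).Nonempty := ⟨0, by simp⟩
  -- The value `1` at `q = 0` keeps `g` positive on a range that is nonempty even if `Q = 0`.
  set g : ℕ → ℝ := fun q => if 1 ≤ q then
    distNearestInt (q * a) * distNearestInt (q * b) / (q : ℝ) ^ (-w) else 1 with hg
  have hgpos : ∀ q, 0 < g q := by
    intro q
    simp only [hg]
    split_ifs with h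
    · have : (0 : ℝ) < q := by exact_mod_cast h
      exact div_pos (hpos q h) (by positivity)
    · norm_num
  obtain ⟨q₀, -, hq₀⟩ := Finset.exists_min_image (Finset.Icc 0 Q) g hne
  refine ⟨min 1 (g q₀), lt_min one_pos (hgpos _), fun q hq => ?_⟩
  have hq' : (0 : ℝ) < q := by exact_mod_cast hq
  have hqw : (0 : ℝ) < (q : ℝ) ^ (-w) := by positivity
  by_cases hqQ : q ≤ Q
  · have h1 := hq₀ q (by simp [hqQ])
    simp only [hg, if_pos hq] at h1
    rw [le_div_iff₀ hqw] at h1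
    exact (mul_le_mul_of_nonneg_right (min_le_right _ _) hqw.le).trans h1
  · have : ¬ (distNearestInt (q * a) * distNearestInt (q * b) ≤ (q : ℝ) ^ (-w)) :=
      fun h => hqQ (hQ ⟨hq, h⟩)
    calc _ ≤ 1 * (q : ℝ) ^ (-w) := mul_le_mul_of_nonneg_right (min_le_left _ _) hqw.le
      _ ≤ _ := by rw [one_mul]; exact (not_le.1 this).le

/-- If both distances were below `2^(-k)`, then `c q^(-w) ≤ 4^(-k)`, and `q ≤ 2^(ks/2 + 1)` would
force `c ≤ 2^w · 2^(k(sw/2 - 2))`, false for large `k` when `sw < 4`. Having `w < 4` is what leaves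
room for `s > 1`. -/
theorem exists_scale {a b : ℝ} (hab : multiplicativeExponent a b < 4) :
    ∃ s : ℝ, 1 < s ∧ s < 4 ∧ ∀ᶠ k : ℕ in Filter.atTop, ∀ q : ℕ, 1 ≤ q → q ≤ 2 ^ ⌈k * s / 2⌉₊ →
      1 / (2 : ℝ) ^ k ≤ max (distNearestInt (q * a)) (distNearestInt (q * b)) := by
  obtain ⟨w, hw1, hw4, hfin⟩ := exists_real_exponent hab
  obtain ⟨c, hc, hcq⟩ := exists_lower_bound hfin
  obtain ⟨s, hs1, hs2⟩ := exists_between (show (1 : ℝ) < 4 / w by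
    rw [lt_div_iff₀ (by linarith)]; linarith)
  have hsw : s * w < 4 := (lt_div_iff₀ (by linarith)).1 hs2
  refine ⟨s, hs1, by nlinarith, ?_⟩
  have hr : Filter.Tendsto (fun k : ℕ => (2 : ℝ) ^ w * ((2 : ℝ) ^ (s * w / 2 - 2)) ^ k)
      Filter.atTop (nhds ((2 : ℝ) ^ w * 0)) :=
    (tendsto_pow_atTop_nhds_zero_of_lt_one (by positivity)
      (Real.rpow_lt_one_of_one_lt_of_neg (by norm_num) (by linarith))).const_mul _
  rw [mul_zero] at hr
  filter_upwards [hr.eventually_lt_const hc] with k hk q hq hqk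
  by_contra hlt
  rw [not_le, max_lt_iff] at hlt
  have hq' : (0 : ℝ) < q := by exact_mod_cast hq
  have h1 : c * (q : ℝ) ^ (-w) ≤ 1 / (2 : ℝ) ^ k * (1 / (2 : ℝ) ^ k) :=
    (hcq q hq).trans (mul_le_mul hlt.1.le hlt.2.le (distNearestInt_nonneg _) (by positivity))
  have h2 : (q : ℝ) ≤ (2 : ℝ) ^ (k * s / 2 + 1) := by
    have : (q : ℝ) ≤ (2 : ℝ) ^ (⌈k * s / 2⌉₊ : ℝ) := by
      rw [Real.rpow_natCast]; exact_mod_cast hqk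
    refine this.trans (Real.rpow_le_rpow_of_exponent_le (by norm_num) ?_)
    exact (Nat.ceil_lt_add_one (by positivity)).le
  have h3 : (q : ℝ) ^ w ≤ (2 : ℝ) ^ ((k * s / 2 + 1) * w) := by
    rw [Real.rpow_mul (by norm_num)]
    exact Real.rpow_le_rpow hq'.le h2 (by linarith)
  have h4 : c ≤ (2 : ℝ) ^ ((k * s / 2 + 1) * w) * (2 : ℝ) ^ (-(2 * k : ℝ)) := by
    have e : (1 / (2 : ℝ) ^ k * (1 / (2 : ℝ) ^ k)) = (2 : ℝ) ^ (-(2 * k : ℝ)) := by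
      rw [Real.rpow_neg (by norm_num), two_mul, Real.rpow_add (by norm_num), Real.rpow_natCast]
      field_simp
    rw [e, Real.rpow_neg hq'.le, ← div_eq_mul_inv, div_le_iff₀ (by positivity)] at h1
    rw [mul_comm]
    exact h1.trans (mul_le_mul_of_nonneg_left h3 (by positivity))
  have e : (2 : ℝ) ^ w * ((2 : ℝ) ^ (s * w / 2 - 2)) ^ k =
      (2 : ℝ) ^ ((k * s / 2 + 1) * w) * (2 : ℝ) ^ (-(2 * k : ℝ)) := by
    rw [← Real.rpow_natCast, ← Real.rpow_mul (by norm_num), ← Real.rpow_add (by norm_num),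
      ← Real.rpow_add (by norm_num)]
    congr 1; ring
  rw [e] at hk
  exact absurd hk (not_lt.2 h4)

/-! ### Measure of the exceptional sets -/

/-- The parameters `β ∈ [-R, R]` such that for some `n ∈ [N, 2N)` both coordinates of
`n (aβ + b, β)` are within `ρ` of an integer and one of them is within `η` of an integer. -/
def blockSet (a b : ℝ) (R N : ℕ) (ρ η : ℝ) : Set ℝ :=
  {β | |β| ≤ R ∧ ∃ n : ℕ, N ≤ n ∧ n < 2 * N ∧
    max (distNearestInt (n * (a * β + b))) (distNearestInt (n * β)) ≤ ρ ∧
    min (distNearestInt (n * (a * β + b))) (distNearestInt (n * β)) ≤ η}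

/-- The pairs `(m, n) ∈ [-M, M)²` for which `am + bn` is within `δ` of an integer. -/
noncomputable def dualBohrSet (a b : ℝ) (M : ℕ) (δ : ℝ) : Finset (ℤ × ℤ) :=
  (Finset.Ico (-(M : ℤ)) M ×ˢ Finset.Ico (-(M : ℤ)) M).filter
    fun p => distNearestInt (a * p.1 + b * p.2) ≤ δ

theorem volume_blockSet_le {a : ℝ} (ha : a ≠ 0) (b : ℝ) {R N : ℕ} (hN : 0 < N) {ρ η : ℝ}
    (hρ : ρ ≤ 1) (hη : 0 ≤ η) :
    volume (blockSet a b R N ρ η) ≤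
      (dualBohrSet a b (2 * N * (R + 1)) ((1 + |a|) * ρ)).card *
        ENNReal.ofReal (2 * η / N * (1 + (2 * ⌈|a|⌉₊ + 5) / |a|)) := by
  have hN' : (0 : ℝ) < N := by exact_mod_cast hN
  have ha' : 0 < |a| := abs_pos.2 ha
  set B := dualBohrSet a b (2 * N * (R + 1)) ((1 + |a|) * ρ) with hB
  -- Possible values of `l - round (am + bn)`, which is at most `1/2 + (1 + |a|)ρ ≤ |a| + 3/2` in
  -- absolute value.
  set T : Finset ℤ := Finset.Icc (-(⌈|a|⌉₊ + 2 : ℤ)) (⌈|a|⌉₊ + 2) with hT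
  have hTcard : T.card = 2 * ⌈|a|⌉₊ + 5 := by
    rw [hT, Int.card_Icc]; omega
  have hsub : blockSet a b R N ρ η ⊆ ⋃ p ∈ B, (Metric.closedBall ((p.1 : ℝ) / p.2) (η / N) ∪
      ⋃ t ∈ T, Metric.closedBall ((((round (a * p.1 + b * p.2) + t : ℤ) : ℝ) / p.2 - b) / a)
        (η / N / |a|)) := by
    rintro β ⟨hβ, n, hNn, hn2, hmax, hmin⟩
    have hn : (0 : ℝ) < n := by exact_mod_cast hN.trans_le hNn
    have hNn' : (N : ℝ) ≤ n := by exact_mod_cast hNn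
    have hn2' : (n : ℝ) + 1 ≤ 2 * N := by exact_mod_cast hn2
    rw [max_le_iff] at hmax
    set m := round (n * β) with hm
    set l := round (n * (a * β + b)) with hl
    have e1 : |n * (a * β + b) - l| ≤ ρ := hmax.1
    have e2 : |n * β - m| ≤ ρ := hmax.2
    have e3 : |a * m + b * n - l| ≤ (1 + |a|) * ρ := by
      have : a * m + b * n - l = (n * (a * β + b) - l) - a * (n * β - m) := by ring
      rw [this]
      refine (abs_sub _ _).trans ?_
      rw [abs_mul]
      nlinarith
    have hmabs : |(m : ℝ)| ≤ n * R + 1 / 2 := by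
      have h1 : |n * β - m| ≤ 1 / 2 := abs_sub_round _
      have h2 : |n * β| ≤ n * R := by
        rw [abs_mul, Nat.abs_cast]; exact mul_le_mul_of_nonneg_left hβ hn.le
      have h3 : (m : ℝ) = n * β - (n * β - m) := by ring
      rw [h3]
      exact (abs_sub _ _).trans (add_le_add h2 h1)
    have hmlt : |(m : ℝ)| < 2 * N * (R + 1) := by
      nlinarith [mul_nonneg (by linarith : (0 : ℝ) ≤ 2 * N - n - 1)
        (Nat.cast_nonneg R : (0 : ℝ) ≤ R), (Nat.cast_nonneg R : (0 : ℝ) ≤ R)]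
    rw [abs_lt] at hmlt
    have hpB : (m, (n : ℤ)) ∈ B := by
      rw [hB, dualBohrSet, Finset.mem_filter, Finset.mem_product, Finset.mem_Ico, Finset.mem_Ico]
      refine ⟨⟨⟨?_, ?_⟩, ?_, ?_⟩, ?_⟩
      · have : ((-(2 * N * (R + 1) : ℕ) : ℤ) : ℝ) ≤ m := by push_cast; linarith
        exact_mod_cast this
      · have : (m : ℝ) < ((2 * N * (R + 1) : ℕ) : ℤ) := by push_cast; linarith
        exact_mod_cast this
      · exact (neg_nonpos.2 (Int.natCast_nonneg _)).trans (Int.natCast_nonneg _)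
      · push_cast
        have : (n : ℤ) < 2 * N := by exact_mod_cast hn2
        nlinarith [(by positivity : (0 : ℤ) ≤ N * R)]
      · refine (distNearestInt_le _ l).trans ?_
        push_cast
        exact e3
    refine Set.mem_biUnion hpB ?_
    rcases min_le_iff.1 hmin with h | h
    · right
      have h' : |n * (a * β + b) - l| ≤ η := h
      have e4 : |a * (m : ℝ) + b * n - round (a * (m : ℝ) + b * n)| ≤ 1 / 2 := abs_sub_round _
      have e5 : |((l - round (a * (m : ℝ) + b * n) : ℤ) : ℝ)| ≤ ⌈|a|⌉₊ + 2 := by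
        have : ((l - round (a * (m : ℝ) + b * n) : ℤ) : ℝ) =
            (a * (m : ℝ) + b * n - round (a * (m : ℝ) + b * n)) - (a * m + b * n - l) := by
          push_cast; ring
        rw [this]
        refine (abs_sub _ _).trans ?_
        nlinarith [Nat.le_ceil |a|]
      have e6 : |l - round (a * (m : ℝ) + b * n)| ≤ (⌈|a|⌉₊ + 2 : ℤ) := by exact_mod_cast e5
      rw [abs_le] at e6
      refine Set.mem_biUnion (x := l - round (a * (m : ℝ) + b * n)) ?_ ?_
      · exact Finset.mem_coe.2 (Finset.mem_Icc.2 e6)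
      · rw [Metric.mem_closedBall, Real.dist_eq, le_div_iff₀ ha', ← abs_mul]
        simp only [Int.cast_natCast, add_sub_cancel]
        have : (β - ((l : ℝ) / n - b) / a) * a = (n * (a * β + b) - l) / n := by
          field_simp; ring
        rw [this, abs_div, abs_of_pos hn]
        exact div_le_div₀ hη h' hN' hNn'
    · left
      have h' : |n * β - m| ≤ η := h
      rw [Metric.mem_closedBall, Real.dist_eq]
      have : β - (m : ℝ) / ((n : ℤ) : ℝ) = (n * β - m) / n := by
        push_cast; field_simp
      simp only
      rw [this, abs_div, abs_of_pos hn]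
      exact div_le_div₀ hη h' hN' hNn'
  refine (measure_mono hsub).trans ((measure_biUnion_finset_le _ _).trans ?_)
  rw [← nsmul_eq_mul]
  refine Finset.sum_le_card_nsmul _ _ _ fun p _ => ?_
  refine (measure_union_le _ _).trans ?_
  refine (add_le_add le_rfl (measure_biUnion_finset_le _ _)).trans ?_
  simp only [Real.volume_closedBall, Finset.sum_const, hTcard]
  rw [← ENNReal.ofReal_nsmul, ← ENNReal.ofReal_add (by positivity) (by positivity)]
  refine ENNReal.ofReal_le_ofReal (le_of_eq ?_)
  rw [nsmul_eq_mul]; push_cast; field_simp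

theorem card_dualBohrSet_le (a b : ℝ) {M : ℕ} (hM : 0 < M) {ρ : ℝ} (hρ : 0 < ρ)
    (hsep : ∀ q : ℕ, 1 ≤ q → q ≤ ⌊1 / ρ⌋₊ →
      1 / (M : ℝ) ≤ max (distNearestInt (q * a)) (distNearestInt (q * b))) :
    ((dualBohrSet a b M ((1 + |a|) * ρ)).card : ℝ) ≤ 41472 * (1 + |a|) * ρ * M ^ 2 := by
  have hA : 0 < 1 + |a| := by positivity
  -- Chosen so that `h ≤ x` gives `h · (1 + |a|)ρ ≤ 1/8`.
  set x := 1 / (8 * (1 + |a|) * ρ) with hx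
  have hx0 : 0 < x := by positivity
  have hx1 : x ≤ 1 / ρ := by
    rw [hx]
    refine one_div_le_one_div_of_le hρ ?_
    nlinarith [mul_nonneg (abs_nonneg a) hρ.le]
  have hcard := card_dualBohr_mul_le (H := ⌊x⌋₊ + 1) hM (by omega) a b
    (dualBohrSet a b M ((1 + |a|) * ρ)) (Finset.filter_subset _ _) ?_ ?_
  · have h1 : x ≤ ((⌊x⌋₊ + 1 : ℕ) : ℝ) := by push_cast; exact (Nat.lt_floor_add_one x).le
    have h2 := (mul_le_mul_of_nonneg_left h1 (Nat.cast_nonneg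
      (dualBohrSet a b M ((1 + |a|) * ρ)).card)).trans hcard
    rw [hx, mul_one_div, div_le_iff₀ (by positivity)] at h2
    linarith
  · intro p hp h hh
    have h1 : (h : ℝ) ≤ x := (Nat.cast_le.2 (Nat.lt_succ_iff.1 hh)).trans (Nat.floor_le hx0.le)
    have h2 := (Finset.mem_filter.1 hp).2
    calc _ ≤ x * ((1 + |a|) * ρ) := mul_le_mul h1 h2 (distNearestInt_nonneg _) hx0.le
      _ = 1 / 8 := by rw [hx]; field_simp
  · intro q hq hqH
    exact hsep q hq ((Nat.lt_succ_iff.1 hqH).trans (Nat.floor_le_floor hx1))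

/-! ### Summation over dyadic blocks -/

/-- Cauchy condensation, with `log n ≥ k log 2` on the block `(2^k, 2^(k+1)]`. -/
theorem summable_two_pow_mul {ψ : ℕ → ℝ≥0} (hψ : AntitoneOn ψ (Set.Ici 1))
    (hsum : Summable (fun n : ℕ => (ψ n : ℝ) * Real.log n)) :
    Summable fun k : ℕ => (2 : ℝ) ^ k * (k * ψ (2 ^ k)) := by
  set f : ℕ → ℝ := fun n => (ψ n : ℝ) * Real.log n with hf
  have hf0 : ∀ n, 0 ≤ f n := fun n => mul_nonneg (ψ n).2 (Real.log_natCast_nonneg n)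
  have hlog2 : 0 < Real.log 2 := Real.log_pos (by norm_num)
  have hblock : ∀ k : ℕ, (2 : ℝ) ^ k * (ψ (2 ^ (k + 1)) * (k * Real.log 2)) ≤
      ∑ n ∈ Finset.range (2 ^ (k + 1) + 1), f n - ∑ n ∈ Finset.range (2 ^ k + 1), f n := by
    intro k
    have hle : 2 ^ k + 1 ≤ 2 ^ (k + 1) + 1 :=
      Nat.succ_le_succ (Nat.pow_le_pow_right (by norm_num) k.le_succ)
    rw [← Finset.sum_Ico_eq_sub _ hle]
    have := Finset.card_nsmul_le_sum (Finset.Ico (2 ^ k + 1) (2 ^ (k + 1) + 1)) f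
      (ψ (2 ^ (k + 1)) * (k * Real.log 2)) ?_
    · rw [Nat.card_Ico, nsmul_eq_mul, show 2 ^ (k + 1) + 1 - (2 ^ k + 1) = 2 ^ k by
        rw [pow_succ]; omega] at this
      push_cast at this
      exact this
    · intro n hn
      rw [Finset.mem_Ico] at hn
      refine mul_le_mul ?_ ?_ (by positivity) (ψ n).2
      · exact_mod_cast hψ (by simp; omega) (Nat.one_le_two_pow (n := k + 1))
          (Nat.lt_succ_iff.1 hn.2)
      · rw [← Real.log_pow]
        refine Real.log_le_log (by positivity) ?_
        exact_mod_cast (Nat.le_succ _).trans hn.1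
  have hs : Summable fun k : ℕ => (2 : ℝ) ^ k * (ψ (2 ^ (k + 1)) * (k * Real.log 2)) := by
    refine summable_of_sum_range_le (c := ∑' n, f n) (fun k => by positivity) fun K => ?_
    refine (Finset.sum_le_sum fun k _ => hblock k).trans ?_
    rw [Finset.sum_range_sub (fun k => ∑ n ∈ Finset.range (2 ^ k + 1), f n)]
    exact (sub_le_self _ (Finset.sum_nonneg fun n _ => hf0 n)).trans
      (hsum.sum_le_tsum _ fun n _ => hf0 n)
  -- The weight `k` in `hs` vanishes at `k = 0`; after the shift the comparison is `2(k + 2) ≤ 4(k +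
  -- 1)`.
  rw [← summable_nat_add_iff 2]
  refine Summable.of_nonneg_of_le (fun k => by positivity) (fun k => ?_)
    (((summable_nat_add_iff 1).2 hs).mul_left (4 / Real.log 2))
  have e : 4 / Real.log 2 * ((2 : ℝ) ^ (k + 1) * (ψ (2 ^ (k + 1 + 1)) *
      (((k + 1 : ℕ) : ℝ) * Real.log 2))) =
      (2 : ℝ) ^ (k + 1) * ψ (2 ^ (k + 1 + 1)) * (4 * (k + 1)) := by
    push_cast; field_simp
  rw [e, show k + 2 = k + 1 + 1 from rfl]
  have : (2 : ℝ) ^ (k + 1 + 1) * (((k + 1 + 1 : ℕ) : ℝ) * ψ (2 ^ (k + 1 + 1))) =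
      (2 : ℝ) ^ (k + 1) * ψ (2 ^ (k + 1 + 1)) * (2 * (k + 2)) := by
    rw [pow_succ _ (k + 1)]; push_cast; ring
  rw [this]
  refine mul_le_mul_of_nonneg_left ?_ (by positivity)
  linarith [(Nat.cast_nonneg k : (0 : ℝ) ≤ k)]

/-- The approximating function at scale `2 ^ k`, kept above `2 ^ (-sk)`. -/
noncomputable def dyadicBound (ψ : ℕ → ℝ≥0) (s : ℝ) (k : ℕ) : ℝ :=
  ψ (2 ^ k) + ((2 : ℝ) ^ (-s)) ^ k

theorem dyadicBound_nonneg (ψ : ℕ → ℝ≥0) (s : ℝ) (k : ℕ) : 0 ≤ dyadicBound ψ s k :=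
  add_nonneg (ψ _).2 (by positivity)

theorem summable_dyadicBound {ψ : ℕ → ℝ≥0} (hψ : AntitoneOn ψ (Set.Ici 1))
    (hsum : Summable (fun n : ℕ => (ψ n : ℝ) * Real.log n)) {s : ℝ} (hs : 1 < s) :
    Summable fun k : ℕ => (2 : ℝ) ^ k * (k * dyadicBound ψ s k) := by
  have h2 : Summable fun k : ℕ => (k : ℝ) ^ 1 * ((2 : ℝ) ^ (1 - s)) ^ k := by
    refine summable_pow_mul_geometric_of_norm_lt_one 1 ?_
    rw [Real.norm_of_nonneg (by positivity)]
    exact Real.rpow_lt_one_of_one_lt_of_neg (by norm_num) (by linarith)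
  refine ((summable_two_pow_mul hψ hsum).add h2).congr fun k => ?_
  rw [dyadicBound, sub_eq_add_neg, Real.rpow_add (by norm_num), Real.rpow_one, mul_pow]
  ring

/-- Take `2^(-j-1) < u ≤ 2^(-j)`. If `u ≤ 2^(-J)`, stop at `J`: there `v ≤ u ≤ 2^(-J) ≤ φ 2^J`,
which is why `φ` must be bounded below. -/
theorem exists_dyadic_scale {u v φ : ℝ} {J : ℕ} (hv : 0 ≤ v) (hvu : v ≤ u) (hu : u ≤ 1)
    (huv : u * v < φ) (hφ : ((1 : ℝ) / 2) ^ J * (1 / 2) ^ J ≤ φ) :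
    ∃ j ≤ J, u ≤ (1 / 2) ^ j ∧ v ≤ 2 * φ * 2 ^ j := by
  have hφ0 : 0 < φ := lt_of_lt_of_le (by positivity) hφ
  have hinv : ∀ j : ℕ, (1 / 2 : ℝ) ^ j * 2 ^ j = 1 := fun j => by rw [← mul_pow]; norm_num
  by_cases h : u ≤ (1 / 2) ^ J
  · refine ⟨J, le_rfl, h, (hvu.trans h).trans ?_⟩
    have h1 := mul_le_mul_of_nonneg_right hφ (by positivity : (0 : ℝ) ≤ 2 ^ J)
    rw [mul_assoc, hinv, mul_one] at h1
    have : 0 ≤ φ * 2 ^ J := by positivity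
    linarith
  · rw [not_le] at h
    have hu0 : 0 < u := lt_trans (by positivity) h
    obtain ⟨j, hj1, hj2⟩ := exists_nat_pow_near_of_lt_one hu0 hu (by norm_num : (0 : ℝ) < 1 / 2)
      (by norm_num)
    refine ⟨j, ?_, hj2, ?_⟩
    · exact ((pow_lt_pow_iff_right_of_lt_one₀ (by norm_num : (0 : ℝ) < 1 / 2)
        (by norm_num)).1 (h.trans_le hj2)).le
    · have h1 : (1 / 2 : ℝ) ^ (j + 1) * v ≤ φ :=
        (mul_le_mul_of_nonneg_right hj1.le hv).trans huv.le
      have h2 := mul_le_mul_of_nonneg_right h1 (by positivity : (0 : ℝ) ≤ 2 ^ (j + 1))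
      rw [mul_right_comm, hinv, one_mul, pow_succ] at h2
      linarith

/-- The parameters `β ∈ [-R, R]` that are exceptional at scale `2 ^ k`. -/
noncomputable def dyadicSet (a b : ℝ) (R : ℕ) (ψ : ℕ → ℝ≥0) (s : ℝ) (k : ℕ) : Set ℝ :=
  ⋃ j ∈ Finset.range (⌈k * s / 2⌉₊ + 1),
    blockSet a b R (2 ^ k) ((1 / 2) ^ j) (2 * dyadicBound ψ s k * 2 ^ j)

theorem mem_dyadicSet {a b : ℝ} {R : ℕ} {ψ : ℕ → ℝ≥0} (hψ : AntitoneOn ψ (Set.Ici 1)) {s β : ℝ}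
    (hβ : |β| ≤ R) {n : ℕ} (hn : 1 ≤ n)
    (h : distNearestInt (n * (a * β + b)) * distNearestInt (n * β) < ψ n) :
    β ∈ dyadicSet a b R ψ s (Nat.log 2 n) := by
  set k := Nat.log 2 n
  have hk1 : 2 ^ k ≤ n := Nat.pow_log_le_self 2 (by omega)
  have hk2 : n < 2 * 2 ^ k := by
    rw [← pow_succ']; exact Nat.lt_pow_succ_log_self (by norm_num) n
  set x := distNearestInt (n * (a * β + b))
  set y := distNearestInt (n * β)
  have hx : x ≤ 1 / 2 := distNearestInt_le_half _
  have hy : y ≤ 1 / 2 := distNearestInt_le_half _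
  have hφ : max x y * min x y < dyadicBound ψ s k := by
    rw [max_mul_min]
    refine h.trans_le (le_trans ?_ (le_add_of_nonneg_right (by positivity)))
    exact_mod_cast hψ (Nat.one_le_two_pow (n := k)) hn hk1
  have hJ : ((1 : ℝ) / 2) ^ ⌈k * s / 2⌉₊ * (1 / 2) ^ ⌈k * s / 2⌉₊ ≤ dyadicBound ψ s k := by
    refine le_trans ?_ (le_add_of_nonneg_left (ψ _).2)
    rw [← pow_add, ← Real.rpow_natCast, ← Real.rpow_natCast, ← Real.rpow_mul (by norm_num),
      one_div, Real.inv_rpow (by norm_num), ← Real.rpow_neg (by norm_num)]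
    refine Real.rpow_le_rpow_of_exponent_le (by norm_num) ?_
    push_cast
    nlinarith [Nat.le_ceil (k * s / 2)]
  obtain ⟨j, hj, h1, h2⟩ := exists_dyadic_scale
    (le_min (distNearestInt_nonneg _) (distNearestInt_nonneg _)) min_le_max
    (max_le (hx.trans (by norm_num)) (hy.trans (by norm_num))) hφ hJ
  exact Set.mem_biUnion (Finset.mem_coe.2 (Finset.mem_range.2 (Nat.lt_succ_iff.2 hj)))
    ⟨hβ, n, hk1, hk2, h1, h2⟩

/-- The product `ρη = 2φ` does not depend on `j`, so all pieces obey the same bound, and there are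
at most `4k` of them. -/
theorem volume_dyadicSet_le {a : ℝ} (ha : a ≠ 0) (b : ℝ) (R : ℕ) (ψ : ℕ → ℝ≥0) {s : ℝ}
    (hs4 : s < 4) : ∃ C : ℝ, 0 ≤ C ∧ ∀ k : ℕ, 1 ≤ k →
      (∀ q : ℕ, 1 ≤ q → q ≤ 2 ^ ⌈k * s / 2⌉₊ →
        1 / (2 : ℝ) ^ k ≤ max (distNearestInt (q * a)) (distNearestInt (q * b))) →
      volume (dyadicSet a b R ψ s k) ≤
        ENNReal.ofReal (C * ((2 : ℝ) ^ k * (k * dyadicBound ψ s k))) := by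
  set K : ℝ := 1 + (2 * ⌈|a|⌉₊ + 5) / |a| with hK
  set C : ℝ := 41472 * (1 + |a|) * (16 * (R + 1) ^ 2) * K with hC
  have hK0 : 0 ≤ K := by positivity
  have hC0 : 0 ≤ C := by positivity
  refine ⟨4 * C, by positivity, fun k hk hsep => ?_⟩
  have hφ := dyadicBound_nonneg ψ s k
  have hblock : ∀ j ∈ Finset.range (⌈k * s / 2⌉₊ + 1),
      volume (blockSet a b R (2 ^ k) ((1 / 2) ^ j) (2 * dyadicBound ψ s k * 2 ^ j)) ≤
        ENNReal.ofReal (C * (2 ^ k * dyadicBound ψ s k)) := by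
    intro j hj
    rw [Finset.mem_range, Nat.lt_succ_iff] at hj
    have hinv : (1 / 2 : ℝ) ^ j * 2 ^ j = 1 := by rw [← mul_pow]; norm_num
    refine (volume_blockSet_le ha b (by positivity)
      (pow_le_one₀ (by norm_num) (by norm_num)) (by positivity)).trans ?_
    rw [← ENNReal.ofReal_natCast, ← ENNReal.ofReal_mul (by positivity)]
    refine ENNReal.ofReal_le_ofReal ?_
    have hcard := card_dualBohrSet_le a b (M := 2 * 2 ^ k * (R + 1)) (ρ := (1 / 2) ^ j)
      (by positivity) (by positivity) ?_
    · refine (mul_le_mul_of_nonneg_right hcard (by positivity)).trans (le_of_eq ?_)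
      rw [← hK, hC]
      push_cast
      have hk0 : (2 : ℝ) ^ k ≠ 0 := by positivity
      calc _ = 41472 * (1 + |a|) * (16 * (R + 1) ^ 2) * K *
            (2 ^ k * (2 ^ k / 2 ^ k) * dyadicBound ψ s k) * ((1 / 2 : ℝ) ^ j * 2 ^ j) := by
              ring
        _ = _ := by rw [hinv, div_self hk0, mul_one, mul_one]
    · intro q hq hqj
      refine le_trans ?_ (hsep q hq ?_)
      · refine one_div_le_one_div_of_le (by positivity) ?_
        push_cast
        nlinarith [(Nat.cast_nonneg R : (0 : ℝ) ≤ R), (by positivity : (0 : ℝ) < 2 ^ k)]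
      · refine hqj.trans (Nat.floor_le_of_le ?_)
        rw [one_div_pow, one_div_one_div]
        exact_mod_cast Nat.pow_le_pow_right (by norm_num) hj
  refine (measure_biUnion_finset_le _ _).trans ((Finset.sum_le_card_nsmul _ _ _ hblock).trans ?_)
  rw [← ENNReal.ofReal_nsmul, Finset.card_range, nsmul_eq_mul]
  refine ENNReal.ofReal_le_ofReal ?_
  have hJ : ((⌈k * s / 2⌉₊ + 1 : ℕ) : ℝ) ≤ 4 * k := by
    have h1 : ⌈k * s / 2⌉₊ ≤ 2 * k := by
      rw [Nat.ceil_le]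
      push_cast
      nlinarith [(Nat.cast_nonneg k : (0 : ℝ) ≤ k)]
    have : ⌈k * s / 2⌉₊ + 1 ≤ 4 * k := by omega
    exact_mod_cast this
  calc _ ≤ (4 * k : ℝ) * (C * (2 ^ k * dyadicBound ψ s k)) :=
        mul_le_mul_of_nonneg_right hJ (by positivity)
    _ = _ := by ring

theorem ne_zero_of_multiplicativeExponent_lt {a b : ℝ} (hab : multiplicativeExponent a b < 4) : a ≠ 0 := by
  obtain ⟨w, -, -, hfin⟩ := exists_real_exponent hab
  obtain ⟨c, hc, hcq⟩ := exists_lower_bound hfin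
  rintro rfl
  have := hcq 1 le_rfl
  simp [distNearestInt] at this
  linarith

theorem ae_finite_setOf_lt {a b : ℝ} (hab : multiplicativeExponent a b < 4)
    {ψ : ℕ → ℝ≥0} (hψ : AntitoneOn ψ (Set.Ici 1))
    (hsum : Summable (fun n : ℕ => (ψ n : ℝ) * Real.log n)) :
    ∀ᵐ β : ℝ, {n : ℕ | 1 ≤ n ∧
      distNearestInt (n * (a * β + b)) * distNearestInt (n * β) < ψ n}.Finite := by
  obtain ⟨s, hs1, hs4, hscale⟩ := exists_scale hab
  have hmain : ∀ R : ℕ, ∀ᵐ β : ℝ, ∀ᶠ k in Filter.atTop, β ∉ dyadicSet a b R ψ s k := by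
    intro R
    obtain ⟨C, hC, hvol⟩ := volume_dyadicSet_le (ne_zero_of_multiplicativeExponent_lt hab) b R ψ hs4
    obtain ⟨k₀, hk₀⟩ := Filter.eventually_atTop.1 (hscale.and (Filter.eventually_ge_atTop 1))
    have hsummable := (summable_dyadicBound hψ hsum hs1).mul_left C
    have hfin : ∑' k, volume (dyadicSet a b R ψ s (k + k₀)) ≠ ⊤ := by
      refine ne_top_of_le_ne_top ((summable_nat_add_iff k₀).2 hsummable).tsum_ofReal_ne_top ?_
      refine ENNReal.tsum_le_tsum fun k => ?_
      have := hk₀ (k + k₀) (Nat.le_add_left _ _)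
      exact hvol _ this.2 this.1
    filter_upwards [ae_eventually_notMem hfin] with β hβ
    obtain ⟨k₁, hk₁⟩ := Filter.eventually_atTop.1 hβ
    filter_upwards [Filter.eventually_ge_atTop (k₁ + k₀)] with k hk
    have := hk₁ (k - k₀) (by omega)
    rwa [Nat.sub_add_cancel (by omega)] at this
  filter_upwards [ae_all_iff.2 hmain] with β hβ
  obtain ⟨R, hR⟩ := exists_nat_ge |β|
  obtain ⟨k₀, hk₀⟩ := Filter.eventually_atTop.1 (hβ R)
  refine (Set.finite_lt_nat (2 ^ k₀)).subset fun n hn => ?_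
  by_contra hlt
  rw [Set.mem_ofPred_eq, not_lt] at hlt
  exact hk₀ _ (Nat.le_log_of_pow_le (by norm_num) hlt) (mem_dyadicSet hψ hR hn.1 hn.2)

/-! ### Transfer to the line -/

/-- The parametrisation `β ↦ (aβ + b, β)` of `planarLine a b`. -/
noncomputable def planarLineParam (a b β : ℝ) : EuclideanSpace ℝ (Fin 2) := !₂[a * β + b, β]

theorem exists_lipschitzWith_planarLineParam (a b : ℝ) :
    ∃ K : ℝ≥0, LipschitzWith K (planarLineParam a b) := by
  refine ⟨_, LipschitzWith.of_dist_le_mul (K := (√(a ^ 2 + 1)).toNNReal) fun x y => ?_⟩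
  rw [EuclideanSpace.dist_eq, Fin.sum_univ_two, Real.coe_toNNReal _ (Real.sqrt_nonneg _)]
  refine Real.sqrt_le_iff.2 ⟨mul_nonneg (Real.sqrt_nonneg _) dist_nonneg, le_of_eq ?_⟩
  rw [mul_pow, Real.sq_sqrt (by positivity)]
  simp only [planarLineParam, Real.dist_eq, sq_abs]
  simp
  ring

/-- Lipschitz maps send Lebesgue-null sets to sets of zero one-dimensional Hausdorff measure. -/
theorem ae_planarLineMeasure {a b : ℝ} {P : EuclideanSpace ℝ (Fin 2) → Prop}
    (h : ∀ᵐ β : ℝ, P (planarLineParam a b β)) : ∀ᵐ p ∂(planarLineMeasure a b), P p := by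
  obtain ⟨K, hK⟩ := exists_lipschitzWith_planarLineParam a b
  have hmeas : MeasurableSet (planarLine a b) := by
    refine IsClosed.measurableSet (isClosed_eq ?_ ?_) <;> fun_prop
  rw [ae_iff] at h
  rw [planarLineMeasure, ae_restrict_iff' hmeas, ae_iff]
  refine measure_mono_null (t := planarLineParam a b '' {β | ¬ P (planarLineParam a b β)}) ?_ ?_
  · intro p hp
    simp only [Set.mem_ofPred_eq, Classical.not_imp] at hp
    have e : planarLineParam a b (p 1) = p := by
      ext i
      fin_cases i
      · exact (hp.1 : p 0 = a * p 1 + b).symm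
      · rfl
    exact ⟨p 1, by rw [Set.mem_ofPred_eq, e]; exact hp.2, e⟩
  · refine le_antisymm ?_ bot_le
    refine (hK.hausdorffMeasure_image_le zero_le_one _).trans ?_
    rw [hausdorffMeasure_real, h, mul_zero]

theorem theorem1p7 (a b : ℝ) (hab : multiplicativeExponent a b < 4)
    (ψ : ℕ → ℝ≥0) (hψ : AntitoneOn ψ (Set.Ici 1))
    (hsum : Summable (fun n : ℕ => (ψ n : ℝ) * Real.log n)) :
    ∀ᵐ p ∂(planarLineMeasure a b),
      {n : ℕ | 1 ≤ n ∧ distNearestInt (n * p 0) * distNearestInt (n * p 1) < ψ n}.Finite := by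
  exact ae_planarLineMeasure (ae_finite_setOf_lt hab hψ hsum)
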